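/- **Individualized privacy of IDP-SGD with the Scale mechanism.** Let $\mathcal X$ be a universe of data points, partitioned into privacy groups $\mathcal G_1,\dots,\mathcal G_P$ with target budgets $\varepsilon_1,\dots,\varepsilon_P\in\mathbb R$, and let $0<\delta\le 1$. Fix, before training, a loss $l(\theta,x)$ with $\theta\in\mathbb R^d$, a law for the initial parameters $\theta_0$, a learning rate $\eta$, an (expected) mini-batch size $B>0$, a number of iterations $I$, a common sampling rate $q\in(0,1]$, a default clip norm $c>0$, noise multipliers $\sigma_1,\dots,\sigma_P>0$ and $\sigma_{\mathrm{scale}}>0$ (for instance $\sigma_{\mathrm{scale}}=(\frac1N\sum_p |\mathcal G_p|/\sigma_p)^{-1}$ for nominal group sizes with total $N$), and set $c_p=\sigma_{\mathrm{scale}}\,c/\sigma_p$. On a finite dataset $D\subseteq\mathcal X$, the algorithm $M$ performs $I$ iterations of the following: draw $L_t\subseteq D$ by including each point independently with probability $q$; for $x\in L_t\cap\mathcal G_p$ let $g=\nabla_\theta l(\theta_t,x)$ (with the convention $g=0$ where $l(\cdot,x)$ is not differentiable) and $\bar g_t(x)=g/\max(1,\|g\|_2/c_p)$; then, with fresh independent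 Gaussian noise, put $$\theta_{t+1}=\theta_t-\frac{\eta}{B}\Big(\sum_{x\in L_t}\bar g_t(x)+\mathcal N\big(0,(\sigma_{\mathrm{scale}}c)^2\mathbf I\big)\Big).$$ Only $\theta_I$ is released. (Since $\sigma_{\mathrm{scale}}c=\sigma_pc_p$, the effective noise multiplier of group $p$ is $\sigma_p$.) Assume that each $\sigma_p$ is calibrated to the budget $(\varepsilon_p,\delta)$: for every $p$ there are an order $\alpha>1$ and a per-step cost $\rho$ with $$I\rho+\log\frac{\alpha-1}{\alpha}-\frac{\log\delta+\log\alpha}{\alpha-1}\le\varepsilon_p ,$$ where either $\rho$ is the Rényi divergence $\mathbb D_\alpha\big((1-q)\mathcal N(0,\sigma_p^2)+q\,\mathcal N(1,\sigma_p^2)\,\big\|\,\mathcal N(0,\sigma_p^2)\big)$ of the sampled Gaussian mechanism, or $\rho=2q^2\alpha/\sigma_p^2$ and, with $\Lambda=\log\big(1+\frac1{q(\alpha-1)}\big)$, $$q\le\tfrac15,\quad \sigma_p\ge4,\quad \alpha\le\tfrac12\sigma_p^2\Lambda-2\log\sigma_p,\quad \alpha\le\frac{\frac12\sigma_p^2\Lambda^2-\log5-2\log\sigma_p}{\Lambda+\log(q\alpha)+1/(2\sigma_p^2)}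 .$$ Then $M$ satisfies $(\{\varepsilon_1,\dots,\varepsilon_P\},\delta)$-individualized differential privacy: for all finite datasets $D,D'\subseteq\mathcal X$ such that one is obtained from the other by removing a single point $x$, with $x\in\mathcal G_p$, and for every measurable set $R\subseteq\mathbb R^d$ (with the same hyperparameters used on $D$ and $D'$), $$\mathbb P[M(D)\in R]\le e^{\varepsilon_p}\,\mathbb P[M(D')\in R]+\delta .$$ -/

import Mathlib

open MeasureTheory ProbabilityTheory

noncomputable section

/-! ### Individualized differential privacy -/

/-- `({ε_1, …, ε_P}, δ)`-individualized differential privacy of a randomized algorithm `M`, given by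
the law `M D` of its output on each finite dataset `D`, where `group x` is the privacy group of the
data point `x`: whenever two datasets differ only in one point `x`, contained in exactly one of
them, and `x` belongs to group `p`, the two output laws are `(ε_p, δ)`-indistinguishable, in both
directions. -/
def IsIDP {𝒳 Ω : Type*} [MeasurableSpace Ω] {P : ℕ} (M : Finset 𝒳 → Measure Ω)
    (group : 𝒳 → Fin P) (ε : Fin P → ℝ) (δ : ℝ) : Prop :=
  ∀ (D : Finset 𝒳) (x : 𝒳) (hx : x ∉ D) (R : Set Ω), MeasurableSet R →
    M (Finset.cons x D hx) R
        ≤ ENNReal.ofReal (Real.exp (ε (group x))) * M D R + ENNReal.ofReal δ ∧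
    M D R
        ≤ ENNReal.ofReal (Real.exp (ε (group x))) * M (Finset.cons x D hx) R + ENNReal.ofReal δ

/-! ### IDP-SGD with the Scale mechanism -/

/-- The hyperparameters of IDP-SGD with the Scale mechanism, all fixed before training, for data
points in `𝒳`, model parameters in `ℝ^d` and `P` privacy groups. -/
structure ScaleConfig (𝒳 : Type*) (d P : ℕ) where
  /-- the privacy group of each data point -/
  group : 𝒳 → Fin P
  /-- the loss `l(θ, x)` -/
  loss : EuclideanSpace ℝ (Fin d) → 𝒳 → ℝ
  /-- the law of the random initial parameters `θ₀` -/
  init : Measure (EuclideanSpace ℝ (Fin d))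
  /-- the learning rate `η` -/
  lr : ℝ
  /-- the (expected) mini-batch size `B`, by which the noisy gradient sum is normalized -/
  batchSize : ℝ
  /-- the sampling rate `q`, common to all data points -/
  q : ℝ
  /-- the default clip norm `c` -/
  c : ℝ
  /-- the noise multipliers `σ_p` targeted for the groups -/
  σ : Fin P → ℝ
  /-- the common noise multiplier `σ_scale` used by the algorithm -/
  σscale : ℝ

/-- Gradient clipping to clip norm `r`: `g / max(1, ‖g‖₂ / r)`. -/
def clipGrad {d : ℕ} (r : ℝ) (g : EuclideanSpace ℝ (Fin d)) : EuclideanSpace ℝ (Fin d) :=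
  (max 1 (‖g‖ / r))⁻¹ • g

namespace ScaleConfig

variable {𝒳 : Type*} {d P : ℕ} (S : ScaleConfig 𝒳 d P)

/-- The individualized clip norm `c_p = σ_scale · c / σ_p` of group `p`. -/
def clipNorm (p : Fin P) : ℝ := S.σscale * S.c / S.σ p

/-- One model update from parameters `θ`, with mini-batch `L` and standard Gaussian noise `z`:
`θ - η · (1/B) · (∑_{x ∈ L} clip_{c_p}(∇_θ l(θ, x)) + σ_scale · c · z)`, where a point `x` of group
`p` is clipped to `c_p`. -/
def update (L : Finset 𝒳) (θ z : EuclideanSpace ℝ (Fin d)) : EuclideanSpace ℝ (Fin d) :=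
  θ - S.lr • (S.batchSize⁻¹ •
    ((∑ x ∈ L, clipGrad (S.clipNorm (S.group x)) (gradient (fun θ' => S.loss θ' x) θ))
      + (S.σscale * S.c) • z))

/-- One training iteration on the dataset `D`, acting on the law `μ` of the current parameters:
the mini-batch `L ⊆ D` is drawn by Poisson sampling (each point independently with probability
`q`), and the noise is standard Gaussian; parameters, mini-batch and noise are independent. -/
def step (D : Finset 𝒳) (μ : Measure (EuclideanSpace ℝ (Fin d))) :
    Measure (EuclideanSpace ℝ (Fin d)) :=
  ∑ L ∈ D.powerset, ENNReal.ofReal (S.q ^ L.card * (1 - S.q) ^ (D.card - L.card)) •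
    (μ.prod (stdGaussian (EuclideanSpace ℝ (Fin d)))).map (fun y => S.update L y.1 y.2)

/-- The law of the released final parameters `θ_I` after `I` iterations of training on `D`. -/
def train (I : ℕ) (D : Finset 𝒳) : Measure (EuclideanSpace ℝ (Fin d)) :=
  (S.step D)^[I] S.init

end ScaleConfig

/-! ### Privacy accounting: the budget met by a noise multiplier -/

/-- The Rényi divergence of order `α` of the real distribution with density `f` from the one with
positive density `g`: `(α - 1)⁻¹ log ∫ f^α g^(1-α)`. -/
def renyiDensity (α : ℝ) (f g : ℝ → ℝ) : ℝ :=
  (α - 1)⁻¹ * Real.log (∫ x, f x ^ α * g x ^ (1 - α))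

/-- The exact Rényi cost of order `α` of one step of the sampled Gaussian mechanism with sampling
rate `q`, sensitivity `1` and noise multiplier `σ`: the Rényi divergence of
`(1 - q) N(0, σ²) + q N(1, σ²)` from `N(0, σ²)`. -/
def sgmExactCost (q σ α : ℝ) : ℝ :=
  renyiDensity α
    (fun x => (1 - q) * gaussianPDFReal 0 (σ ^ 2).toNNReal x
      + q * gaussianPDFReal 1 (σ ^ 2).toNNReal x)
    (gaussianPDFReal 0 (σ ^ 2).toNNReal)

/-- The closed-form bound `2 q² α / σ²` on the Rényi cost of one step. -/
def sgmClosedFormCost (q σ α : ℝ) : ℝ := 2 * q ^ 2 * α / σ ^ 2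

/-- The parameter regime in which the closed-form bound is used, with
`L = log (1 + 1 / (q (α - 1)))`. -/
def ClosedFormRegime (q σ α : ℝ) : Prop :=
  q ≤ 1 / 5 ∧ 4 ≤ σ ∧
  α ≤ σ ^ 2 * Real.log (1 + 1 / (q * (α - 1))) / 2 - 2 * Real.log σ ∧
  α ≤ (σ ^ 2 * Real.log (1 + 1 / (q * (α - 1))) ^ 2 / 2 - Real.log 5 - 2 * Real.log σ) /
      (Real.log (1 + 1 / (q * (α - 1))) + Real.log (q * α) + 1 / (2 * σ ^ 2))

/-- The `ε` that the conversion from Rényi to approximate differential privacy assigns to total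
Rényi cost `ρ` at order `α` and failure probability `δ`. -/
def rdpToDP (α ρ δ : ℝ) : ℝ :=
  ρ + Real.log ((α - 1) / α) - (Real.log δ + Real.log α) / (α - 1)

/-- What the accountant certifies when a noise multiplier `σ` is selected for the target budget
`(ε, δ)`, sampling rate `q` and `I` iterations: for some order `α > 1`, the `I`-fold Rényi cost of
one step (exact, or by the closed-form bound in its regime), converted to approximate differential
privacy, is at most `ε`. -/
def MeetsBudget (q δ : ℝ) (I : ℕ) (σ ε : ℝ) : Prop :=
  ∃ α : ℝ, 1 < α ∧
    (rdpToDP α (I * sgmExactCost q σ α) δ ≤ ε ∨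
      (ClosedFormRegime q σ α ∧ rdpToDP α (I * sgmClosedFormCost q σ α) δ ≤ ε))

end

/-!
# Privacy of IDP-SGD with the Scale mechanism

Relative to its noise, a point of group `p` contributes to a training iteration a vector of norm at
most `c_p / (σ_scale c) = 1 / σ_p`. Hence, for given current parameters and a given mini-batch of
the other points, adding a point `x` replaces the standard Gaussian noise by the mixture
`(1 - q) N(0, 1) + q N(v, 1)` with `‖v‖ ≤ 1 / σ_p` (`ScaleConfig.transition_cons`), whose density
`shiftRatio` is known from the Cameron-Martin formula `map_add_stdGaussian`. It depends only on one
Gaussian coordinate, so its moments are those of the one-dimensional `sgmRatio`, and they are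
monotone in the size of the shift (`sgmMoment_mono`). The opposite direction, where the mixture is
the reference measure, costs no more: this is `sgmMoment_one_sub_le`, which reduces by reflection
to the pointwise inequality `add_rpow_one_sub_le_add_rpow`.

Bounds on the Rényi divergence are used in their dual form, `HolderDominated`: the integral of a
test function under one law is bounded through Hölder's inequality by an integral under the other.
In this form no density of the law of the parameters is needed. Composition over the iterations
amounts to applying Hölder's inequality to the transition operators (`HolderDominated.comp`), and
mixing over mini-batches to Jensen's inequality (`sum_lintegral_mul_le`). Nothing is lost at the
end: for indicators, Young's inequality yields exactly the conversion `rdpToDP`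
(`HolderDominated.measure_le`).

The closed-form cost dominates the exact one in its regime (`sgmExactCost_le_sgmClosedFormCost`).
The likelihood ratio to the power `α` is bounded by a quadratic polynomial up to the threshold
`α / (α - 1)`, and by an exponential beyond; the conditions of the regime make the contribution of
the exponential of the same order `q² α (α - 1) / σ²` as the variance term
(`tail_le_of_closedFormRegime`).
-/

noncomputable section

/-! ### Inequalities between real powers -/

lemma hasDerivAt_rpow_sub_rpow_one_sub {α u : ℝ} (hu : 0 < u) :
    HasDerivAt (fun u : ℝ => u ^ α - u ^ (1 - α))
      (α * u ^ (α - 1) + (α - 1) * u ^ (-α)) u := by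
  have h := (Real.hasDerivAt_rpow_const (p := α) (Or.inl hu.ne')).sub
    (Real.hasDerivAt_rpow_const (p := 1 - α) (Or.inl hu.ne'))
  refine h.congr_deriv ?_
  rw [show 1 - α - 1 = -α by ring]; ring

lemma hasDerivAt_deriv_rpow_sub_rpow_one_sub {α u : ℝ} (hu : 0 < u) :
    HasDerivAt (fun u : ℝ => α * u ^ (α - 1) + (α - 1) * u ^ (-α))
      (α * (α - 1) * (u ^ (α - 2) - u ^ (-α - 1))) u := by
  have h := ((Real.hasDerivAt_rpow_const (p := α - 1) (Or.inl hu.ne')).const_mul α).add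
    ((Real.hasDerivAt_rpow_const (p := -α) (Or.inl hu.ne')).const_mul (α - 1))
  refine h.congr_deriv ?_
  rw [show α - 1 - 1 = α - 2 by ring]; ring

lemma convexOn_rpow_sub_rpow_one_sub {α : ℝ} (hα : 1 < α) :
    ConvexOn ℝ (Set.Ici 1) (fun u : ℝ => u ^ α - u ^ (1 - α)) := by
  refine convexOn_of_hasDerivWithinAt2_nonneg (convex_Ici 1) ?_ (f' := fun u => _)
    (f'' := fun u => _)
    (fun u hu => (hasDerivAt_rpow_sub_rpow_one_sub ?_).hasDerivWithinAt)
    (fun u hu => (hasDerivAt_deriv_rpow_sub_rpow_one_sub ?_).hasDerivWithinAt) ?_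
  · intro u hu
    exact (hasDerivAt_rpow_sub_rpow_one_sub
      (zero_lt_one.trans_le hu)).continuousAt.continuousWithinAt
  · rw [interior_Ici] at hu; exact zero_lt_one.trans hu
  · rw [interior_Ici] at hu; exact zero_lt_one.trans hu
  · intro u hu
    rw [interior_Ici] at hu
    refine mul_nonneg (by nlinarith) (sub_nonneg.2 ?_)
    exact Real.rpow_le_rpow_of_exponent_le (le_of_lt hu) (by linarith)

lemma concaveOn_rpow_sub_rpow_one_sub {α : ℝ} (hα : 1 < α) :
    ConcaveOn ℝ (Set.Ioc 0 1) (fun u : ℝ => u ^ α - u ^ (1 - α)) := by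
  refine concaveOn_of_hasDerivWithinAt2_nonpos (convex_Ioc 0 1) ?_ (f' := fun u => _)
    (f'' := fun u => _)
    (fun u hu => (hasDerivAt_rpow_sub_rpow_one_sub ?_).hasDerivWithinAt)
    (fun u hu => (hasDerivAt_deriv_rpow_sub_rpow_one_sub ?_).hasDerivWithinAt) ?_
  · intro u hu
    exact (hasDerivAt_rpow_sub_rpow_one_sub hu.1).continuousAt.continuousWithinAt
  · rw [interior_Ioc] at hu; exact hu.1
  · rw [interior_Ioc] at hu; exact hu.1
  · intro u hu
    rw [interior_Ioc] at hu
    refine mul_nonpos_of_nonneg_of_nonpos (by nlinarith) (sub_nonpos.2 ?_)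
    exact Real.rpow_le_rpow_of_exponent_ge hu.1 hu.2.le (by linarith)

/-- The inequality of reversed Rényi integrands for the two-point masses `(1, t)` and `(w, v)`,
where `(w, v)` has the same total and lies between `(1, t)` and its mirror image `(t, 1)`. With
`φ u = u ^ α - u ^ (1 - α)`, it compares the slopes of the secants of `φ` between `1` and the two
points `w` and `t / v`, of which `w` is the larger. -/
lemma add_rpow_one_sub_le_add_rpow {α t w v : ℝ} (hα : 1 < α) (ht : 0 < t) (hw : 0 < w)
    (hv : 0 < v) (hsum : w + v = 1 + t) (hprod : t ≤ w * v) :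
    w ^ (1 - α) + t ^ α * v ^ (1 - α) ≤ w ^ α + t ^ (1 - α) * v ^ α := by
  set φ : ℝ → ℝ := fun u => u ^ α - u ^ (1 - α) with hφ
  have hφ1 : φ 1 = 0 := by simp [hφ]
  have hu : 0 < t / v := div_pos ht hv
  have hvφ : v * φ (t / v) = t ^ α * v ^ (1 - α) - t ^ (1 - α) * v ^ α := by
    have h1 : v = v ^ α * v ^ (1 - α) := by
      rw [← Real.rpow_add hv]; simp
    have hvα := (Real.rpow_pos_of_pos hv α).ne'
    have hvα' := (Real.rpow_pos_of_pos hv (1 - α)).ne'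
    simp only [hφ]
    rw [Real.div_rpow ht.le hv.le, Real.div_rpow ht.le hv.le]
    nth_rewrite 1 [h1]
    field_simp
  have huw : t / v ≤ w := by rwa [div_le_iff₀ hv]
  suffices v * φ (t / v) ≤ φ w by
    rw [hvφ] at this; simp only [hφ] at this; linarith
  have htv : v * (t / v - 1) = w - 1 := by field_simp; linarith
  rcases lt_trichotomy w 1 with h | h | h
  · have hu1 : t / v < 1 := lt_of_le_of_lt huw h
    have hs := (concaveOn_rpow_sub_rpow_one_sub hα).neg.secant_mono (a := 1) (x := t / v) (y := w)
      ⟨one_pos, le_rfl⟩ ⟨hu, hu1.le⟩ ⟨hw, h.le⟩ hu1.ne h.ne huw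
    change (-φ (t / v) - -φ 1) / (t / v - 1) ≤ (-φ w - -φ 1) / (w - 1) at hs
    rw [hφ1] at hs
    have h3 := mul_le_mul_of_nonpos_left hs (show w - 1 ≤ 0 by linarith)
    rw [mul_div_cancel₀ _ (by linarith : w - 1 ≠ 0)] at h3
    rw [← htv, mul_assoc, mul_div_cancel₀ _ (by linarith : t / v - 1 ≠ 0)] at h3
    linarith
  · have : t / v = 1 := by
      have : t / v - 1 = 0 := by
        rcases mul_eq_zero.1 (htv.trans (by linarith)) with h0 | h0
        · exact absurd h0 hv.ne'
        · exact h0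
      linarith
    rw [this, h, hφ1, mul_zero]
  · have hu1 : 1 < t / v := by
      have : 0 < t / v - 1 := by
        refine (mul_pos_iff_of_pos_left hv).1 ?_
        rw [htv]; linarith
      linarith
    have hs := (convexOn_rpow_sub_rpow_one_sub hα).secant_mono (a := 1) (x := t / v) (y := w)
      (by simp) hu1.le h.le hu1.ne' h.ne' huw
    change (φ (t / v) - φ 1) / (t / v - 1) ≤ (φ w - φ 1) / (w - 1) at hs
    rw [hφ1] at hs
    have h3 := mul_le_mul_of_nonneg_left hs (show 0 ≤ w - 1 by linarith)
    rw [mul_div_cancel₀ _ (by linarith : w - 1 ≠ 0)] at h3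
    rw [← htv, mul_assoc, mul_div_cancel₀ _ (by linarith : t / v - 1 ≠ 0)] at h3
    linarith

lemma two_mul_le_log_one_add {x : ℝ} (hx : -(1 / 5) ≤ x) (hx0 : x ≤ 0) :
    2 * x ≤ Real.log (1 + x) := by
  have h := Real.one_sub_inv_le_log_of_pos (show 0 < 1 + x by linarith)
  refine le_trans ?_ h
  rw [le_sub_comm, inv_le_comm₀ (by linarith) (by linarith),
    inv_le_comm₀ (by linarith) (by linarith)]
  rw [inv_le_iff_one_le_mul₀ (by linarith)]
  nlinarith

lemma one_add_rpow_le_quadratic {α x : ℝ} (hα : 1 < α) (hx : -(1 / 5) ≤ x)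
    (hx' : x ≤ 1 / (α - 1)) : (1 + x) ^ α ≤ 1 + α * x + α * (α - 1) * x ^ 2 := by
  set f : ℝ → ℝ := fun x => 1 + α * x + α * (α - 1) * x ^ 2 - (1 + x) ^ α with hf
  have hα1 : 0 < α - 1 := by linarith
  have hd : ∀ y : ℝ, -1 < y →
      HasDerivAt f (α * (1 + 2 * (α - 1) * y - (1 + y) ^ (α - 1))) y := by
    intro y hy
    have h1 : HasDerivAt (fun y : ℝ => (1 + y) ^ α) (1 * α * (1 + y) ^ (α - 1)) y :=
      ((hasDerivAt_id y).const_add 1).rpow_const (Or.inl (show (1 : ℝ) + y ≠ 0 by linarith))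
    have h2 := (((hasDerivAt_id y).const_mul α).const_add 1).add
      (((hasDerivAt_id y).pow 2).const_mul (α * (α - 1)))
    refine (h2.sub h1).congr_deriv ?_
    simp only [id, Nat.cast_ofNat, Nat.add_one_sub_one, pow_one]
    ring
  have hf0 : f 0 = 0 := by simp [hf]
  suffices 0 ≤ f x by simp only [hf] at this; linarith
  have hcont : ∀ s : Set ℝ, (∀ y ∈ s, -1 < y) → ContinuousOn f s :=
    fun s hs y hy => (hd y (hs y hy)).continuousAt.continuousWithinAt
  rcases le_total x 0 with h0 | h0
  · have hanti : AntitoneOn f (Set.Icc (-(1 / 5)) 0) := by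
      refine antitoneOn_of_hasDerivWithinAt_nonpos (convex_Icc _ _)
        (hcont _ fun y hy => by linarith [hy.1])
        (fun y hy => (hd y ?_).hasDerivWithinAt) ?_
      · rw [interior_Icc] at hy; linarith [hy.1]
      · intro y hy
        rw [interior_Icc] at hy
        refine mul_nonpos_of_nonneg_of_nonpos (by linarith) ?_
        -- `(1 + y) ^ (α - 1) ≥ 1 + (α - 1) log (1 + y)`
        have hlog := two_mul_le_log_one_add hy.1.le hy.2.le
        have hexp := Real.add_one_le_exp (Real.log (1 + y) * (α - 1))
        rw [← Real.rpow_def_of_pos (by linarith [hy.1])] at hexp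
        nlinarith
    have := hanti ⟨hx, h0⟩ ⟨by norm_num, le_rfl⟩ h0
    rwa [hf0] at this
  · have hmono : MonotoneOn f (Set.Icc 0 (1 / (α - 1))) := by
      refine monotoneOn_of_hasDerivWithinAt_nonneg (convex_Icc _ _)
        (hcont _ fun y hy => by linarith [hy.1])
        (fun y hy => (hd y ?_).hasDerivWithinAt) ?_
      · rw [interior_Icc] at hy; linarith [hy.1]
      · intro y hy
        rw [interior_Icc] at hy
        refine mul_nonneg (by linarith) ?_
        -- `(1 + y) ^ (α - 1) ≤ exp s ≤ 1 + s + s ^ 2` for `s = (α - 1) y ∈ [0, 1]`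
        have hs0 : 0 < (α - 1) * y := mul_pos hα1 hy.1
        have hs1 : (α - 1) * y ≤ 1 := by
          have := mul_le_mul_of_nonneg_left hy.2.le hα1.le
          rwa [mul_one_div_cancel hα1.ne'] at this
        have h1 : (1 + y) ^ (α - 1) ≤ Real.exp ((α - 1) * y) := by
          rw [mul_comm, Real.exp_mul]
          exact Real.rpow_le_rpow (by linarith [hy.1]) (by linarith [Real.add_one_le_exp y]) hα1.le
        have h2 := (abs_le.1 (Real.abs_exp_sub_one_sub_id_le (abs_le.2 ⟨by linarith, hs1⟩))).2
        nlinarith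
    have := hmono ⟨le_rfl, by positivity⟩ ⟨h0, hx'⟩ h0
    rwa [hf0] at this

/-- The contribution of the Gaussian tail to the Rényi integral of the sampled Gaussian mechanism
is of second order in `q`. Write `x = q (α - 1)`, so that `exp (-L) = x / (1 + x)`. If `x ≥ 2/5`,
the last condition of the regime gives the bound; otherwise `L ≥ 1` and `exp (-σ² L² / 2)` is
small enough by itself. -/
lemma tail_le_of_closedFormRegime {q σ α : ℝ} (hq : 0 < q) (hα : 1 < α)
    (h : ClosedFormRegime q σ α) :
    (α / (α - 1)) ^ α * Real.exp (-(σ ^ 2 * Real.log (1 + 1 / (q * (α - 1))) ^ 2 / 2)) ≤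
      15 / 16 * (q ^ 2 * α * (α - 1) / σ ^ 2) := by
  obtain ⟨hq5, hσ, -, h4⟩ := h
  have ha : 0 < α - 1 := by linarith
  have hs : 16 ≤ σ ^ 2 := by nlinarith
  set x := q * (α - 1) with hx
  have hx0 : 0 < x := mul_pos hq ha
  set L := Real.log (1 + 1 / x) with hL
  have hLexp : Real.exp (-L) = x / (1 + x) := by
    rw [Real.exp_neg, hL, Real.exp_log (by positivity)]; field_simp; ring
  have hα0 : 0 < α := by linarith
  have hr : 0 < α / (α - 1) := by positivity
  have hK : (α / (α - 1)) ^ α = Real.exp (α * Real.log (α / (α - 1))) := by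
    rw [Real.rpow_def_of_pos hr, mul_comm]
  have hrhs : q ^ 2 * α * (α - 1) / σ ^ 2 = x ^ 2 / σ ^ 2 * (α / (α - 1)) := by
    rw [hx]; field_simp
  have hr1 : 1 ≤ α / (α - 1) := by rw [le_div_iff₀ ha]; linarith
  rw [hrhs]
  rcases le_total (2 / 5) x with hc | hc
  · have hden : L + Real.log (q * α) = Real.log (α / (α - 1)) + Real.log (1 + x) := by
      rw [hL, ← Real.log_mul (by positivity) (by positivity),
        ← Real.log_mul (by positivity) (by positivity)]
      congr 1
      rw [hx]; field_simp; ring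
    have hlog1 : 0 ≤ Real.log (α / (α - 1)) := Real.log_nonneg hr1
    have hlog2 : 0 ≤ Real.log (1 + x) := Real.log_nonneg (by linarith)
    have hinv : 0 < 1 / (2 * σ ^ 2) := by positivity
    rw [hden, le_div_iff₀ (by linarith)] at h4
    have h5 : α * Real.log (α / (α - 1)) + -(σ ^ 2 * L ^ 2 / 2)
        ≤ -(Real.log 5 + Real.log (σ ^ 2) + Real.log (1 + x)) := by
      rw [Real.log_pow]
      push_cast
      nlinarith [mul_nonneg ha.le hlog2, mul_pos hα0 hinv]
    rw [hK, ← Real.exp_add]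
    refine (Real.exp_le_exp.2 h5).trans ?_
    rw [← Real.log_mul (by norm_num) (by positivity),
      ← Real.log_mul (by positivity) (by positivity),
      Real.exp_neg, Real.exp_log (by positivity)]
    calc (5 * σ ^ 2 * (1 + x))⁻¹ ≤ 15 / 16 * (x ^ 2 / σ ^ 2 * 1) := by
          rw [inv_le_iff_one_le_mul₀ (by positivity)]
          have : 15 / 16 * (x ^ 2 / σ ^ 2 * 1) * (5 * σ ^ 2 * (1 + x))
              = 75 / 16 * (x ^ 2 * (1 + x)) := by field_simp; norm_num
          rw [this]
          nlinarith [mul_self_nonneg (x - 2 / 5)]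
      _ ≤ _ := by gcongr
  · have hL1 : 1 ≤ L := by
      have h1 : Real.exp (-L) ≤ Real.exp (-1) := by
        rw [hLexp]
        have : x / (1 + x) ≤ 2 / 7 := by
          rw [div_le_div_iff₀ (by linarith) (by norm_num)]; linarith
        have h2 := Real.exp_neg_one_gt_d9
        linarith
      linarith [Real.exp_le_exp.1 h1]
    have hxL : Real.exp (-L) ≤ x := by
      rw [hLexp, div_le_iff₀ (by linarith)]; nlinarith
    have hK' : (α / (α - 1)) ^ α ≤ Real.exp 1 * (α / (α - 1)) := by
      have h1 : (α / (α - 1)) ^ α = (α / (α - 1)) ^ (α - 1) * (α / (α - 1)) := by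
        rw [← Real.rpow_add_one hr.ne']; congr 1; ring
      rw [h1]
      gcongr
      have h2 : α / (α - 1) ≤ Real.exp (1 / (α - 1)) := by
        have := Real.add_one_le_exp (1 / (α - 1))
        have h3 : α / (α - 1) = 1 / (α - 1) + 1 := by field_simp; ring
        linarith
      calc _ ≤ Real.exp (1 / (α - 1)) ^ (α - 1) := Real.rpow_le_rpow hr.le h2 ha.le
        _ = _ := by rw [← Real.exp_mul, one_div_mul_cancel ha.ne']
    have hlogs : Real.log (σ ^ 2) ≤ σ ^ 2 / 16 + 2 := by
      have h1 := Real.log_le_sub_one_of_pos (show 0 < σ ^ 2 / 16 by positivity)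
      have h16 : Real.log 16 = 4 * Real.log 2 := by
        rw [show (16 : ℝ) = 2 ^ 4 by norm_num, Real.log_pow]; norm_num
      rw [Real.log_div (by positivity) (by norm_num), h16] at h1
      have := Real.log_two_lt_d9
      linarith
    have hmain : 1 + -(σ ^ 2 * L ^ 2 / 2) ≤ -1 + (-L + -L) - Real.log (σ ^ 2) := by
      nlinarith [mul_nonneg (sub_nonneg.2 hs) (sub_nonneg.2 hL1),
        mul_nonneg (by positivity : 0 ≤ σ ^ 2 * L) (sub_nonneg.2 hL1)]
    calc (α / (α - 1)) ^ α * Real.exp (-(σ ^ 2 * L ^ 2 / 2))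
        ≤ Real.exp 1 * (α / (α - 1)) * Real.exp (-(σ ^ 2 * L ^ 2 / 2)) := by gcongr
      _ = Real.exp (1 + -(σ ^ 2 * L ^ 2 / 2)) * (α / (α - 1)) := by rw [Real.exp_add]; ring
      _ ≤ Real.exp (-1 + (-L + -L) - Real.log (σ ^ 2)) * (α / (α - 1)) := by gcongr
      _ = Real.exp (-1) * (Real.exp (-L) * Real.exp (-L) / σ ^ 2 * (α / (α - 1))) := by
          rw [Real.exp_sub, Real.exp_log (by positivity), Real.exp_add, Real.exp_add]; ring
      _ ≤ 15 / 16 * (x * x / σ ^ 2 * (α / (α - 1))) := by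
          gcongr
          have := Real.exp_neg_one_lt_d9
          linarith
      _ = _ := by ring

/-! ### The one-dimensional sampled Gaussian mechanism -/

/-- The density of `(1 - q) N(0, a) + q N(a, a)` with respect to `N(0, a)`. Up to rescaling, this
is the sampled Gaussian mechanism with noise multiplier `1 / √a`; in this scale a shift by `a` is
a tilt by `exp (y - a / 2)`. -/
def sgmRatio (q a y : ℝ) : ℝ := 1 - q + q * Real.exp (y - a / 2)

/-- The moment of order `α` of `sgmRatio q a` under `N(0, a)`. -/
def sgmMoment (q : ℝ) (a : NNReal) (α : ℝ) : ENNReal :=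
  ∫⁻ y, ENNReal.ofReal (sgmRatio q a y ^ α) ∂gaussianReal 0 a

lemma sgmRatio_pos {q : ℝ} (hq : 0 < q) (hq1 : q ≤ 1) (a y : ℝ) : 0 < sgmRatio q a y := by
  have := mul_pos hq (Real.exp_pos (y - a / 2))
  unfold sgmRatio; linarith

@[fun_prop]
lemma measurable_sgmRatio (q a : ℝ) : Measurable (sgmRatio q a) := by
  unfold sgmRatio; fun_prop

lemma lintegral_gaussianReal_self (a : NNReal) {g : ℝ → ENNReal} (hg : Measurable g) :
    ∫⁻ y, g y ∂gaussianReal a a =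
      ∫⁻ y, ENNReal.ofReal (Real.exp (y - a / 2)) * g y ∂gaussianReal 0 a := by
  rcases eq_or_ne a 0 with rfl | ha
  · simp [gaussianReal_zero_var, lintegral_dirac' _ hg]
  · rw [gaussianReal_of_var_ne_zero _ ha, gaussianReal_of_var_ne_zero _ ha,
      lintegral_withDensity_eq_lintegral_mul _ (measurable_gaussianPDF _ _) hg,
      lintegral_withDensity_eq_lintegral_mul _ (measurable_gaussianPDF _ _) (by fun_prop)]
    refine lintegral_congr fun y => ?_
    simp only [Pi.mul_apply]
    rw [← mul_assoc, gaussianPDF, gaussianPDF, ← ENNReal.ofReal_mul (gaussianPDFReal_nonneg _ _ _)]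
    congr 2
    have ha' : (a : ℝ) ≠ 0 := by exact_mod_cast ha
    rw [gaussianPDFReal, gaussianPDFReal, mul_assoc _ (Real.exp _), ← Real.exp_add]
    congr 2
    field_simp; ring

/-- The reflection `y ↦ a - y` exchanges `N(0, a)` and `N(a, a)`. -/
lemma lintegral_exp_mul_comp_sub (a : NNReal) {g : ℝ → ENNReal} (hg : Measurable g) :
    ∫⁻ y, ENNReal.ofReal (Real.exp (y - a / 2)) * g (a - y) ∂gaussianReal 0 a =
      ∫⁻ y, g y ∂gaussianReal 0 a := by
  rw [← lintegral_gaussianReal_self a (g := fun y => g (a - y)) (by fun_prop)]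
  have h := gaussianReal_map_const_sub (μ := a) (v := a) (a : ℝ)
  rw [sub_self] at h
  rw [← h, lintegral_map hg (by fun_prop)]

/-- The Rényi divergence of `N(0, a)` from `(1 - q) N(0, a) + q N(a, a)` is at most the one in the
opposite direction. Both moments are symmetrized under the reflection exchanging `N(0, a)` and
`N(a, a)`; the symmetrized integrands then compare pointwise. -/
lemma sgmMoment_one_sub_le {q α : ℝ} (hq : 0 < q) (hq1 : q ≤ 1) (hα : 1 < α) (a : NNReal) :
    sgmMoment q a (1 - α) ≤ sgmMoment q a α := by
  set t : ℝ → ℝ := fun y => Real.exp (y - a / 2) with ht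
  set v : ℝ → ℝ := fun y => (1 - q) * t y + q with hv
  have ht0 : ∀ y, 0 < t y := fun y => Real.exp_pos _
  have hv0 : ∀ y, 0 < v y := fun y => by
    have := mul_nonneg (sub_nonneg.2 hq1) (ht0 y).le
    simp only [hv]; linarith
  have hmt : Measurable t := by fun_prop
  have hmv : Measurable v := by fun_prop
  have hrefl : ∀ y, sgmRatio q a (a - y) = v y / t y := fun y => by
    have h1 : Real.exp (a - y - a / 2) = (t y)⁻¹ := by
      rw [ht, ← Real.exp_neg]; congr 1; ring
    rw [sgmRatio, h1, eq_div_iff (ht0 y).ne', add_mul, mul_assoc, inv_mul_cancel₀ (ht0 y).ne',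
      mul_one]
  have key : ∀ β : ℝ, sgmMoment q a β + sgmMoment q a β =
      ∫⁻ y, ENNReal.ofReal (sgmRatio q a y ^ β + t y ^ (1 - β) * v y ^ β) ∂gaussianReal 0 a := by
    intro β
    have h2 : sgmMoment q a β =
        ∫⁻ y, ENNReal.ofReal (t y ^ (1 - β) * v y ^ β) ∂gaussianReal 0 a := by
      rw [sgmMoment, ← lintegral_exp_mul_comp_sub a (by fun_prop)]
      refine lintegral_congr fun y => ?_
      rw [← ENNReal.ofReal_mul (Real.exp_pos _).le, hrefl,
        Real.div_rpow (hv0 y).le (ht0 y).le, Real.rpow_sub (ht0 y), Real.rpow_one]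
      congr 1
      simp only [ht]; ring
    nth_rewrite 2 [h2]
    rw [sgmMoment, ← lintegral_add_left (by fun_prop)]
    refine lintegral_congr fun y => ?_
    rw [ENNReal.ofReal_add (Real.rpow_nonneg (sgmRatio_pos hq hq1 _ _).le _)
      (mul_nonneg (Real.rpow_nonneg (ht0 y).le _) (Real.rpow_nonneg (hv0 y).le _))]
  have hle : sgmMoment q a (1 - α) + sgmMoment q a (1 - α) ≤
      sgmMoment q a α + sgmMoment q a α := by
    rw [key, key]
    refine lintegral_mono fun y => ENNReal.ofReal_le_ofReal ?_
    rw [show 1 - (1 - α) = α by ring]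
    refine add_rpow_one_sub_le_add_rpow hα (ht0 y) (sgmRatio_pos hq hq1 _ _) (hv0 y) ?_ ?_
    · simp only [sgmRatio, hv, ht]; ring
    · have : sgmRatio q a y * v y - t y = q * (1 - q) * (t y - 1) ^ 2 := by
        simp only [sgmRatio, hv, ht]; ring
      nlinarith [mul_nonneg (mul_nonneg hq.le (sub_nonneg.2 hq1)) (sq_nonneg (t y - 1))]
  rw [← two_mul, ← two_mul] at hle
  exact (ENNReal.mul_le_mul_iff_right (by norm_num) (by norm_num)).1 hle

lemma integral_exp_mul_gaussianReal (a : NNReal) (c : ℝ) :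
    ∫ y, Real.exp (c * y) ∂gaussianReal 0 a = Real.exp (a * c ^ 2 / 2) := by
  have := congrFun (mgf_id_gaussianReal (μ := 0) (v := a)) c
  simpa [mgf] using this

/-- The likelihood ratio is a martingale in the variance: averaging the one for variance `a + b`
over an independent increment of variance `b` gives the one for variance `a`. -/
lemma lintegral_sgmRatio (q : ℝ) (hq : 0 < q) (hq1 : q ≤ 1) (a b : NNReal) (x : ℝ) :
    ∫⁻ y, ENNReal.ofReal (sgmRatio q (a + b) (x + y)) ∂gaussianReal 0 b =
      ENNReal.ofReal (sgmRatio q a x) := by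
  have hint : Integrable (fun y => q * Real.exp (x - (a + b) / 2) * Real.exp (1 * y))
      (gaussianReal 0 b) := (integrable_exp_mul_gaussianReal 1).const_mul _
  have hfun : (fun y => sgmRatio q (a + b) (x + y)) =
      fun y => (1 - q) + q * Real.exp (x - (a + b) / 2) * Real.exp (1 * y) := by
    ext y
    rw [sgmRatio, mul_assoc q, ← Real.exp_add]; ring_nf
  have hint' : Integrable (fun y => sgmRatio q (a + b) (x + y)) (gaussianReal 0 b) := by
    rw [hfun]; exact (integrable_const _).add hint
  rw [← ofReal_integral_eq_lintegral_ofReal hint'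
    (ae_of_all _ fun _ => (sgmRatio_pos hq hq1 _ _).le), hfun,
    integral_add (integrable_const _) hint,
    integral_const_mul, integral_exp_mul_gaussianReal, integral_const, sgmRatio, mul_assoc,
    ← Real.exp_add]
  congr 1
  simp only [probReal_univ, one_smul]
  ring_nf

lemma lintegral_rpow_le_lintegral_rpow {Ω : Type*} [MeasurableSpace Ω] (μ : Measure Ω)
    [IsProbabilityMeasure μ] {p : ℝ} (hp : 1 < p) {f : Ω → ENNReal} (hf : Measurable f) :
    (∫⁻ x, f x ∂μ) ^ p ≤ ∫⁻ x, f x ^ p ∂μ := by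
  have hpq := Real.HolderConjugate.conjExponent hp
  have h := ENNReal.lintegral_mul_le_Lp_mul_Lq μ hpq hf.aemeasurable
    (aemeasurable_const (b := (1 : ENNReal)))
  simp only [Pi.mul_apply, mul_one, ENNReal.one_rpow, lintegral_const, measure_univ] at h
  have h2 := ENNReal.rpow_le_rpow h (zero_le_one.trans hp.le)
  rwa [← ENNReal.rpow_mul, one_div_mul_cancel (zero_lt_one.trans hp).ne', ENNReal.rpow_one] at h2

/-- A smaller shift, relative to the noise, has a smaller Rényi moment: `N(0, b)` is the
convolution of `N(0, a)` and `N(0, b - a)`, and averaging the likelihood ratio over the second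
factor can only decrease its moments. -/
lemma sgmMoment_mono {q α : ℝ} (hq : 0 < q) (hq1 : q ≤ 1) (hα : 1 < α) {a b : NNReal}
    (hab : a ≤ b) : sgmMoment q a α ≤ sgmMoment q b α := by
  obtain ⟨c, rfl⟩ := exists_add_of_le hab
  have hconv : gaussianReal 0 (a + c) = (gaussianReal 0 a).conv (gaussianReal 0 c) := by
    rw [gaussianReal_conv_gaussianReal, add_zero]
  have hα0 : 0 ≤ α := by linarith
  rw [sgmMoment, sgmMoment, hconv, Measure.lintegral_conv (by fun_prop)]
  refine lintegral_mono fun x => ?_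
  rw [← ENNReal.ofReal_rpow_of_nonneg (sgmRatio_pos hq hq1 _ _).le hα0,
    ← lintegral_sgmRatio q hq hq1 a c]
  refine (lintegral_rpow_le_lintegral_rpow _ hα (by fun_prop)).trans_eq ?_
  refine lintegral_congr fun y => ?_
  rw [NNReal.coe_add, ENNReal.ofReal_rpow_of_nonneg (sgmRatio_pos hq hq1 _ _).le hα0]

lemma integrable_exp_add_const_gaussianReal (a : NNReal) (c k : ℝ) :
    Integrable (fun y => Real.exp (c * y + k)) (gaussianReal 0 a) := by
  simp_rw [Real.exp_add]
  exact (integrable_exp_mul_gaussianReal c).mul_const _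

lemma integral_exp_add_const_gaussianReal (a : NNReal) (c k : ℝ) :
    ∫ y, Real.exp (c * y + k) ∂gaussianReal 0 a = Real.exp (a * c ^ 2 / 2 + k) := by
  simp_rw [Real.exp_add]
  rw [integral_mul_const, integral_exp_mul_gaussianReal]

lemma integrable_sgmRatio_rpow {q α : ℝ} (hq : 0 < q) (hq1 : q ≤ 1) (hα : 1 < α) (a : NNReal) :
    Integrable (fun y => sgmRatio q a y ^ α) (gaussianReal 0 a) := by
  refine Integrable.mono' (g := fun y => (1 - q) + q * Real.exp (α * y + -(α * (a / 2))))
    ((integrable_const _).add ((integrable_exp_add_const_gaussianReal a _ _).const_mul q))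
    (Measurable.aestronglyMeasurable (by fun_prop)) (ae_of_all _ fun y => ?_)
  rw [Real.norm_of_nonneg (Real.rpow_nonneg (sgmRatio_pos hq hq1 _ _).le _)]
  have h := (convexOn_rpow hα.le).2 (Set.mem_Ici.2 zero_le_one)
    (Set.mem_Ici.2 (Real.exp_pos (y - a / 2)).le) (sub_nonneg.2 hq1) hq.le (by ring)
  simp only [smul_eq_mul, mul_one, Real.one_rpow] at h
  rw [← Real.exp_mul] at h
  rw [show α * y + -(α * ((a : ℝ) / 2)) = (y - a / 2) * α by ring]
  exact h

lemma sgmMoment_eq_ofReal_integral {q α : ℝ} (hq : 0 < q) (hq1 : q ≤ 1) (hα : 1 < α)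
    (a : NNReal) :
    sgmMoment q a α = ENNReal.ofReal (∫ y, sgmRatio q a y ^ α ∂gaussianReal 0 a) :=
  (ofReal_integral_eq_lintegral_ofReal (integrable_sgmRatio_rpow hq hq1 hα a)
    (ae_of_all _ fun _ => Real.rpow_nonneg (sgmRatio_pos hq hq1 _ _).le _)).symm

/-- Rescaling by `σ²` turns the exact Rényi cost into a moment of `sgmRatio q (1 / σ²)`. -/
lemma sgmExactCost_eq {q σ α : ℝ} (hq : 0 < q) (hq1 : q ≤ 1) (hσ : 0 < σ) :
    sgmExactCost q σ α = (α - 1)⁻¹ * Real.log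
      (∫ y, sgmRatio q ((1 / σ ^ 2).toNNReal) y ^ α ∂gaussianReal 0 (1 / σ ^ 2).toNNReal) := by
  have hσ2 : 0 < σ ^ 2 := by positivity
  have hne : (σ ^ 2).toNNReal ≠ 0 := (Real.toNNReal_pos.2 hσ2).ne'
  have hcoe : ((σ ^ 2).toNNReal : ℝ) = σ ^ 2 := Real.coe_toNNReal _ hσ2.le
  have hcoe' : ((1 / σ ^ 2).toNNReal : ℝ) = 1 / σ ^ 2 := Real.coe_toNNReal _ (by positivity)
  have hmap : (gaussianReal 0 (σ ^ 2).toNNReal).map (· / σ ^ 2) =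
      gaussianReal 0 (1 / σ ^ 2).toNNReal := by
    rw [gaussianReal_map_div_const, zero_div]
    congr 1
    ext
    rw [NNReal.coe_div, hcoe, hcoe', NNReal.coe_mk]
    field_simp
  rw [sgmExactCost, renyiDensity, ← hmap, integral_map (by fun_prop)
    (Measurable.aestronglyMeasurable (by fun_prop)), integral_gaussianReal_eq_integral_smul hne]
  congr 3
  ext x
  have hp := gaussianPDFReal_pos 0 (σ ^ 2).toNNReal x hne
  have hratio : (1 - q) * gaussianPDFReal 0 (σ ^ 2).toNNReal x
      + q * gaussianPDFReal 1 (σ ^ 2).toNNReal x =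
      gaussianPDFReal 0 (σ ^ 2).toNNReal x * sgmRatio q ((1 / σ ^ 2).toNNReal) (x / σ ^ 2) := by
    have h1 : gaussianPDFReal 1 (σ ^ 2).toNNReal x =
        gaussianPDFReal 0 (σ ^ 2).toNNReal x * Real.exp (x / σ ^ 2 - 1 / σ ^ 2 / 2) := by
      rw [gaussianPDFReal, gaussianPDFReal, mul_assoc _ (Real.exp _), ← Real.exp_add, hcoe]
      congr 2
      field_simp; ring
    rw [h1, sgmRatio, hcoe']; ring
  rw [hratio, Real.mul_rpow hp.le (sgmRatio_pos hq hq1 _ _).le, smul_eq_mul, mul_right_comm,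
    ← Real.rpow_add hp]
  simp

lemma sgmMoment_eq_exp_sgmExactCost {q σ α : ℝ} (hq : 0 < q) (hq1 : q ≤ 1) (hσ : 0 < σ)
    (hα : 1 < α) :
    sgmMoment q (1 / σ ^ 2).toNNReal α =
      ENNReal.ofReal (Real.exp ((α - 1) * sgmExactCost q σ α)) := by
  rw [sgmMoment_eq_ofReal_integral hq hq1 hα, sgmExactCost_eq hq hq1 hσ,
    mul_inv_cancel_left₀ (by linarith), Real.exp_log]
  rw [integral_pos_iff_support_of_nonneg
    (fun y => Real.rpow_nonneg (sgmRatio_pos hq hq1 _ _).le _)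
    (integrable_sgmRatio_rpow hq hq1 hα _)]
  rw [Set.eq_univ_of_forall (s := Function.support _) fun y =>
    (Real.rpow_pos_of_pos (sgmRatio_pos hq hq1 _ y) α).ne']
  simp

/-- Where the likelihood ratio is at most `α / (α - 1)`, which is at `y ≤ A / 2 + L`, its power is
bounded by a quadratic polynomial; beyond that point, by any exponential with rate `β ≥ α`. -/
lemma sgmRatio_rpow_le {q α A L β : ℝ} (hq : 0 < q) (hq5 : q ≤ 1 / 5) (hα : 1 < α)
    (hLexp : Real.exp L = 1 + 1 / (q * (α - 1))) (hL0 : 0 ≤ L) (hβα : α ≤ β) (y : ℝ) :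
    sgmRatio q A y ^ α ≤
      (1 + α * (q * (Real.exp (1 * y + -(A / 2)) - 1)) + α * (α - 1) *
        (q ^ 2 * (Real.exp (2 * y + -A) - 2 * Real.exp (1 * y + -(A / 2)) + 1))) +
        (α / (α - 1)) ^ α * Real.exp (β * y + -(β * (A / 2 + L))) := by
  have hα1 : 0 < α - 1 := by linarith
  have hq1 : q ≤ 1 := by linarith
  set K := (α / (α - 1)) ^ α
  have hK : 0 ≤ K := by positivity
  set y₁ : ℝ := A / 2 + L
  set x : ℝ := q * (Real.exp (1 * y + -(A / 2)) - 1) with hx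
  have hE := Real.exp_pos (1 * y + -(A / 2 : ℝ))
  have hratio : sgmRatio q A y = 1 + x := by
    rw [sgmRatio, hx, one_mul, ← sub_eq_add_neg]; ring
  have hsq : q ^ 2 * (Real.exp (2 * y + -A) - 2 * Real.exp (1 * y + -(A / 2)) + 1) = x ^ 2 := by
    have : Real.exp (2 * y + -A) = Real.exp (1 * y + -(A / 2)) ^ 2 := by
      rw [← Real.exp_nat_mul]; congr 1; push_cast; ring
    rw [this, hx]; ring
  have hxq : -(1 / 5) ≤ x := by nlinarith [mul_pos hq hE]
  rw [hsq, hratio]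
  rcases le_total y y₁ with hy | hy
  · have h1 : x ≤ 1 / (α - 1) := by
      have : Real.exp (1 * y + -(A / 2)) ≤ Real.exp L := Real.exp_le_exp.2 (by
        simp only [y₁] at hy; linarith)
      rw [hLexp] at this
      have := mul_le_mul_of_nonneg_left this hq.le
      have h2 : q * (1 + 1 / (q * (α - 1))) = q + 1 / (α - 1) := by field_simp
      rw [hx]; linarith
    have h2 := one_add_rpow_le_quadratic hα hxq h1
    have h3 : 0 ≤ K * Real.exp (β * y + -(β * y₁)) := by positivity
    linarith
  · have h1 : Real.exp (1 * y + -(A / 2)) = Real.exp (y - y₁) * Real.exp L := by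
      rw [← Real.exp_add]; congr 1; simp only [y₁]; ring
    have h2 : 1 ≤ Real.exp (y - y₁) := Real.one_le_exp (by linarith)
    have h3 : 1 + x ≤ α / (α - 1) * Real.exp (y - y₁) := by
      have h4 : q * Real.exp L = q + 1 / (α - 1) := by rw [hLexp]; field_simp
      have h5 : α / (α - 1) = 1 + 1 / (α - 1) := by field_simp; ring
      have h6 : x = Real.exp (y - y₁) * (q * Real.exp L) - q := by rw [hx, h1]; ring
      rw [h5, h6, h4]
      nlinarith [mul_nonneg (sub_nonneg.2 hq1) (sub_nonneg.2 h2)]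
    have hx0 : 0 ≤ x := by
      have : 1 ≤ Real.exp (1 * y + -(A / 2)) := by
        rw [h1]; exact one_le_mul_of_one_le_of_one_le h2 (Real.one_le_exp hL0)
      rw [hx]; exact mul_nonneg hq.le (by linarith)
    have h4 : (1 + x) ^ α ≤ K * Real.exp (β * y + -(β * y₁)) := by
      calc (1 + x) ^ α ≤ (α / (α - 1) * Real.exp (y - y₁)) ^ α :=
            Real.rpow_le_rpow (by linarith) h3 (by linarith)
        _ = K * Real.exp (α * (y - y₁)) := by
            rw [Real.mul_rpow (by positivity) (Real.exp_pos _).le, ← Real.exp_mul, mul_comm α]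
        _ ≤ _ := by
            gcongr
            nlinarith [mul_nonneg (sub_nonneg.2 hβα) (sub_nonneg.2 hy)]
    have h5 : 0 ≤ α * x := mul_nonneg (by linarith) hx0
    have h6 : 0 ≤ α * (α - 1) * x ^ 2 := by positivity
    linarith

/-- The pointwise bound `sgmRatio_rpow_le`, integrated: the linear term has mean zero, and the
square of the deviation of the likelihood ratio from `1` has mean `q² (exp A - 1)`. -/
lemma integral_sgmRatio_rpow_le {q α L β : ℝ} (A : NNReal) (hq : 0 < q) (hq5 : q ≤ 1 / 5)
    (hα : 1 < α) (hLexp : Real.exp L = 1 + 1 / (q * (α - 1))) (hL0 : 0 ≤ L) (hβα : α ≤ β) :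
    ∫ y, sgmRatio q A y ^ α ∂gaussianReal 0 A ≤
      1 + α * (α - 1) * (q ^ 2 * (Real.exp A - 1)) +
        (α / (α - 1)) ^ α * Real.exp (A * β ^ 2 / 2 + -(β * (A / 2 + L))) := by
  have hq1 : q ≤ 1 := by linarith
  have hpt := sgmRatio_rpow_le (A := A) hq hq5 hα hLexp hL0 hβα
  set K := (α / (α - 1)) ^ α
  set y₁ : ℝ := A / 2 + L
  have hI := integrable_exp_add_const_gaussianReal A
  have hi1 : Integrable (fun y => α * (q * (Real.exp (1 * y + -(A / 2 : ℝ)) - 1)))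
      (gaussianReal 0 A) := (((hI _ _).sub (integrable_const _)).const_mul _).const_mul _
  have hi4 : Integrable (fun y => Real.exp (2 * y + -(A : ℝ)) -
      2 * Real.exp (1 * y + -(A / 2 : ℝ))) (gaussianReal 0 A) := (hI _ _).sub ((hI _ _).const_mul 2)
  have hi2 : Integrable (fun y => α * (α - 1) *
      (q ^ 2 * (Real.exp (2 * y + -(A : ℝ)) - 2 * Real.exp (1 * y + -(A / 2 : ℝ)) + 1)))
      (gaussianReal 0 A) :=
    ((hi4.add (integrable_const _)).const_mul _).const_mul _
  have hi3 : Integrable (fun y => K * Real.exp (β * y + -(β * y₁))) (gaussianReal 0 A) :=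
    (hI _ _).const_mul _
  refine (integral_mono (integrable_sgmRatio_rpow hq hq1 hα A)
    ((((integrable_const _).add hi1).add hi2).add hi3) hpt).trans_eq ?_
  have e0 : Real.exp ((A : ℝ) * 1 ^ 2 / 2 + -(A / 2)) = 1 := by
    rw [show (A : ℝ) * 1 ^ 2 / 2 + -(A / 2) = 0 by ring, Real.exp_zero]
  have e1 : Real.exp ((A : ℝ) * 2 ^ 2 / 2 + -A) = Real.exp A := by congr 1; ring
  rw [integral_add' (((integrable_const _).add hi1).add hi2) hi3,
    integral_add' ((integrable_const _).add hi1) hi2, integral_add' (integrable_const _) hi1,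
    integral_const_mul, integral_const_mul, integral_sub (hI _ _) (integrable_const _),
    integral_const_mul, integral_const_mul, integral_const_mul,
    integral_add hi4 (integrable_const _),
    integral_sub (hI _ _) ((hI _ _).const_mul 2), integral_const_mul,
    integral_exp_add_const_gaussianReal, integral_exp_add_const_gaussianReal,
    integral_exp_add_const_gaussianReal, e0, e1]
  simp only [integral_const, probReal_univ, one_smul]
  ring

/-- In its regime, the closed-form bound dominates the exact Rényi cost. Where the likelihood ratio
is at most `α / (α - 1)`, its power is bounded by a quadratic polynomial with expectation
`1 + α (α - 1) q² (exp (1 / σ²) - 1)`; the remaining tail is bounded by an exponential moment. -/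
lemma sgmExactCost_le_sgmClosedFormCost {q σ α : ℝ} (hq : 0 < q) (hα : 1 < α)
    (h : ClosedFormRegime q σ α) : sgmExactCost q σ α ≤ sgmClosedFormCost q σ α := by
  have htail := tail_le_of_closedFormRegime hq hα h
  obtain ⟨hq5, hσ4, h3, -⟩ := h
  have hq1 : q ≤ 1 := by linarith
  have hσ : 0 < σ := by linarith
  have hα1 : 0 < α - 1 := by linarith
  have hs : 16 ≤ σ ^ 2 := by nlinarith
  rw [sgmExactCost_eq hq hq1 hσ]
  set A : NNReal := (1 / σ ^ 2).toNNReal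
  have hA : (A : ℝ) = 1 / σ ^ 2 := Real.coe_toNNReal _ (by positivity)
  set L := Real.log (1 + 1 / (q * (α - 1))) with hL
  have hLexp : Real.exp L = 1 + 1 / (q * (α - 1)) := Real.exp_log (by positivity)
  have hL0 : 0 ≤ L := Real.log_nonneg (by
    have : 0 < 1 / (q * (α - 1)) := by positivity
    linarith)
  set K := (α / (α - 1)) ^ α
  have hK : 0 ≤ K := by positivity
  -- the exponent that is optimal in the Chernoff bound for the tail beyond `1 / (2 σ²) + L`
  set β : ℝ := 1 / 2 + σ ^ 2 * L with hβ
  have hβα : α ≤ β := by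
    have : 0 ≤ Real.log σ := Real.log_nonneg (by linarith)
    nlinarith [mul_nonneg (sq_nonneg σ) hL0]
  have hval := integral_sgmRatio_rpow_le A hq hq5 hα hLexp hL0 hβα
  have hexp : Real.exp (A * β ^ 2 / 2 + -(β * (A / 2 + L))) ≤ Real.exp (-(σ ^ 2 * L ^ 2 / 2)) := by
    refine Real.exp_le_exp.2 ?_
    have : (A : ℝ) * β ^ 2 / 2 + -(β * (A / 2 + L)) =
        -(σ ^ 2 * L ^ 2 / 2) - L / 2 - 1 / (8 * σ ^ 2) := by
      simp only [hβ, hA]; field_simp; ring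
    have h8 : 0 ≤ 1 / (8 * σ ^ 2) := by positivity
    rw [this]; linarith
  have hexpA : Real.exp A - 1 ≤ 17 / 16 * (1 / σ ^ 2) := by
    have h1 : 1 / σ ^ 2 ≤ 1 / 16 := one_div_le_one_div_of_le (by norm_num) hs
    have h0 : 0 ≤ 1 / σ ^ 2 := by positivity
    have := (abs_le.1 (Real.abs_exp_sub_one_sub_id_le
      (abs_le.2 ⟨by linarith, by linarith⟩ : |1 / σ ^ 2| ≤ 1))).2
    rw [hA]; nlinarith
  have htotal : ∫ y, sgmRatio q A y ^ α ∂gaussianReal 0 A ≤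
      1 + (α - 1) * sgmClosedFormCost q σ α := by
    have h1 : α * (α - 1) * (q ^ 2 * (Real.exp A - 1)) ≤
        α * (α - 1) * (q ^ 2 * (17 / 16 * (1 / σ ^ 2))) := by gcongr
    have h2 := (mul_le_mul_of_nonneg_left hexp hK).trans htail
    have h3 : (α - 1) * sgmClosedFormCost q σ α =
        α * (α - 1) * (q ^ 2 * (17 / 16 * (1 / σ ^ 2))) +
          15 / 16 * (q ^ 2 * α * (α - 1) / σ ^ 2) := by
      rw [sgmClosedFormCost]; field_simp; ring
    linarith
  rw [inv_mul_le_iff₀ hα1]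
  -- the integral is in fact positive, but the bound holds for the junk value `log 0 = 0` as well
  rcases (integral_nonneg fun y => Real.rpow_nonneg
    (sgmRatio_pos hq hq1 A y).le α : 0 ≤ ∫ y, sgmRatio q A y ^ α ∂gaussianReal 0 A).eq_or_lt
    with h0 | h0
  · rw [← h0, Real.log_zero, sgmClosedFormCost]; positivity
  · linarith [Real.log_le_sub_one_of_pos h0]

/-! ### Shifts of the standard Gaussian measure -/

/-- The density of `(1 - q) N(0, 1) + q N(v, 1)` with respect to the standard Gaussian measure. -/
def shiftRatio {E : Type*} [NormedAddCommGroup E] [InnerProductSpace ℝ E] (q : ℝ) (v y : E) : ℝ :=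
  sgmRatio q (‖v‖ ^ 2).toNNReal (inner ℝ v y)

lemma shiftRatio_pos {E : Type*} [NormedAddCommGroup E] [InnerProductSpace ℝ E] {q : ℝ}
    (hq : 0 < q) (hq1 : q ≤ 1) (v y : E) : 0 < shiftRatio q v y :=
  sgmRatio_pos hq hq1 _ _

section Shift

variable {E : Type*} [NormedAddCommGroup E] [InnerProductSpace ℝ E] [FiniteDimensional ℝ E]
  [MeasurableSpace E] [BorelSpace E]

/-- The Laplace-Fourier transform of the standard Gaussian measure. -/
lemma integral_cexp_inner_stdGaussian (v t : E) :
    ∫ y, Complex.exp ((inner ℝ v y : ℝ) + (inner ℝ y t : ℝ) * Complex.I) ∂stdGaussian E =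
      Complex.exp (((‖v‖ ^ 2 : ℝ) - (‖t‖ ^ 2 : ℝ)) / 2 + (inner ℝ v t : ℝ) * Complex.I) := by
  set b := stdOrthonormalBasis ℝ E
  have hexp : ∀ x : Fin (Module.finrank ℝ E) → ℝ,
      Complex.exp ((inner ℝ v (∑ i, x i • b i) : ℝ) + (inner ℝ (∑ i, x i • b i) t : ℝ) * Complex.I)
        = ∏ i, Complex.exp (((inner ℝ v (b i) : ℝ) + (inner ℝ (b i) t : ℝ) * Complex.I) * x i) := by
    intro x
    rw [← Complex.exp_sum, sum_inner, inner_sum]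
    congr 1
    push_cast
    rw [Finset.sum_mul, ← Finset.sum_add_distrib]
    refine Finset.sum_congr rfl fun i _ => ?_
    rw [real_inner_smul_left, real_inner_smul_right]
    push_cast
    ring
  have h1 : ∀ z : ℂ, ∫ x : ℝ, Complex.exp (z * x) ∂gaussianReal 0 1 = Complex.exp (z ^ 2 / 2) := by
    intro z
    simpa [complexMGF] using complexMGF_id_gaussianReal (μ := 0) (v := 1) z
  rw [stdGaussian_eq_map_pi_orthonormalBasis b, integral_map (Measurable.aemeasurable (by fun_prop))
    (Measurable.aestronglyMeasurable (by fun_prop))]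
  simp_rw [hexp]
  rw [integral_fintype_prod_eq_prod (f := fun i (x : ℝ) =>
    Complex.exp (((inner ℝ v (b i) : ℝ) + (inner ℝ (b i) t : ℝ) * Complex.I) * x))]
  simp_rw [h1]
  rw [← Complex.exp_sum, ← b.sum_sq_inner_right t, ← b.sum_sq_inner_left v,
    ← b.sum_inner_mul_inner v t]
  congr 1
  push_cast
  rw [← Finset.sum_sub_distrib, Finset.sum_mul, Finset.sum_div, ← Finset.sum_add_distrib]
  refine Finset.sum_congr rfl fun i _ => ?_
  linear_combination ((inner ℝ (b i) t : ℝ) : ℂ) ^ 2 / 2 * Complex.I_sq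

lemma map_inner_stdGaussian (v : E) :
    (stdGaussian E).map (fun y => inner ℝ v y) = gaussianReal 0 (‖v‖ ^ 2).toNNReal := by
  have h := IsGaussian.map_eq_gaussianReal (μ := stdGaussian E) (innerSL ℝ v)
  rw [integral_strongDual_stdGaussian, variance_dual_stdGaussian, innerSL_apply_norm] at h
  exact h

lemma integrable_exp_inner_stdGaussian (v : E) :
    Integrable (fun y => Real.exp (inner ℝ v y - ‖v‖ ^ 2 / 2)) (stdGaussian E) := by
  have h : Integrable (fun x : ℝ => Real.exp (1 * x + -(‖v‖ ^ 2 / 2)))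
      ((stdGaussian E).map (fun y => inner ℝ v y)) := by
    rw [map_inner_stdGaussian]
    exact integrable_exp_add_const_gaussianReal _ _ _
  have h2 := h.comp_measurable (f := fun y : E => inner ℝ v y) (by fun_prop)
  simpa [Function.comp_def, sub_eq_add_neg] using h2

/-- The Cameron-Martin formula in finite dimension. -/
lemma map_add_stdGaussian (v : E) :
    (stdGaussian E).map (fun y => y + v) =
      (stdGaussian E).withDensity
        (fun y => ENNReal.ofReal (Real.exp (inner ℝ v y - ‖v‖ ^ 2 / 2))) := by
  have hint := integrable_exp_inner_stdGaussian v
  have : IsFiniteMeasure ((stdGaussian E).map (fun y => y + v)) := by infer_instance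
  have : IsFiniteMeasure ((stdGaussian E).withDensity
      (fun y => ENNReal.ofReal (Real.exp (inner ℝ v y - ‖v‖ ^ 2 / 2)))) :=
    isFiniteMeasure_withDensity hint.lintegral_lt_top.ne
  refine Measure.ext_of_charFun (funext fun t => ?_)
  rw [charFun_apply, charFun_apply, integral_map (by fun_prop)
      (Measurable.aestronglyMeasurable (by fun_prop)),
    integral_withDensity_eq_integral_toReal_smul (by fun_prop) (ae_of_all _ fun _ => by simp)]
  have hl : ∀ y : E, Complex.exp ((inner ℝ (y + v) t : ℝ) * Complex.I) =
      Complex.exp ((inner ℝ v t : ℝ) * Complex.I) *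
        Complex.exp ((inner ℝ (0 : E) y : ℝ) + (inner ℝ y t : ℝ) * Complex.I) := by
    intro y
    rw [← Complex.exp_add, inner_add_left, inner_zero_left]
    push_cast
    ring_nf
  have hr : ∀ y : E, (ENNReal.ofReal (Real.exp (inner ℝ v y - ‖v‖ ^ 2 / 2))).toReal •
      Complex.exp ((inner ℝ y t : ℝ) * Complex.I) = Complex.exp (-(‖v‖ ^ 2 : ℝ) / 2) *
        Complex.exp ((inner ℝ v y : ℝ) + (inner ℝ y t : ℝ) * Complex.I) := by
    intro y
    rw [ENNReal.toReal_ofReal (Real.exp_pos _).le, Complex.real_smul, Complex.ofReal_exp,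
      ← Complex.exp_add, ← Complex.exp_add]
    push_cast
    ring_nf
  simp_rw [hl, hr]
  rw [integral_const_mul, integral_const_mul, integral_cexp_inner_stdGaussian,
    integral_cexp_inner_stdGaussian, ← Complex.exp_add, ← Complex.exp_add, inner_zero_left,
    norm_zero]
  congr 1
  push_cast
  ring

@[fun_prop]
lemma measurable_shiftRatio (q : ℝ) (v : E) : Measurable (shiftRatio q v) := by
  unfold shiftRatio; fun_prop

/-- The function `shiftRatio q v` is the density of the noise that is shifted by `v` with
probability `q`. -/
lemma lintegral_shiftRatio_mul {q : ℝ} (hq : 0 < q) (hq1 : q ≤ 1) (v : E) {g : E → ENNReal}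
    (hg : Measurable g) :
    ∫⁻ y, ENNReal.ofReal (shiftRatio q v y) * g y ∂stdGaussian E =
      ENNReal.ofReal (1 - q) * ∫⁻ y, g y ∂stdGaussian E +
        ENNReal.ofReal q * ∫⁻ y, g (y + v) ∂stdGaussian E := by
  have h1 : ∫⁻ y, g (y + v) ∂stdGaussian E =
      ∫⁻ y, ENNReal.ofReal (Real.exp (inner ℝ v y - ‖v‖ ^ 2 / 2)) * g y ∂stdGaussian E := by
    rw [← lintegral_map (f := g) (g := fun y => y + v) hg (by fun_prop), map_add_stdGaussian,
      lintegral_withDensity_eq_lintegral_mul _ (by fun_prop) hg]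
    rfl
  rw [h1, ← lintegral_const_mul _ hg, ← lintegral_const_mul _ (by fun_prop),
    ← lintegral_add_left (by fun_prop)]
  refine lintegral_congr fun y => ?_
  rw [shiftRatio, sgmRatio, Real.coe_toNNReal _ (sq_nonneg _),
    ENNReal.ofReal_add (sub_nonneg.2 hq1) (mul_pos hq (Real.exp_pos _)).le,
    ENNReal.ofReal_mul hq.le, add_mul, mul_assoc]

lemma lintegral_shiftRatio_rpow (q β : ℝ) (v : E) :
    ∫⁻ y, ENNReal.ofReal (shiftRatio q v y ^ β) ∂stdGaussian E =
      sgmMoment q (‖v‖ ^ 2).toNNReal β := by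
  rw [sgmMoment, ← map_inner_stdGaussian, lintegral_map (by fun_prop) (by fun_prop)]
  rfl

end Shift

/-! ### Hölder domination -/

/-- Hölder domination of `μ` by `ν` with constant `C`: for every nonnegative test function `h`,
`∫ h dμ ≤ C^(1/p) (∫ h^p' dν)^(1/p')`, with `p'` the exponent conjugate to `p`. This is the dual
form of `∫ (dμ/dν)^p dν ≤ C`, that is, of a bound on the Rényi divergence of order `p`. -/
def HolderDominated {Ω : Type*} [MeasurableSpace Ω] (p : ℝ) (C : ENNReal) (μ ν : Measure Ω) :
    Prop :=
  ∀ h : Ω → ENNReal, Measurable h →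
    ∫⁻ x, h x ∂μ ≤ C ^ (1 / p) * (∫⁻ x, h x ^ p.conjExponent ∂ν) ^ (1 / p.conjExponent)

section Holder

variable {Ω : Type*} [MeasurableSpace Ω] {p : ℝ}

lemma holderDominated_self (hp : 1 < p) (μ : Measure Ω) [IsProbabilityMeasure μ] :
    HolderDominated p 1 μ μ := by
  intro h hh
  have hpq := Real.HolderConjugate.conjExponent hp
  have h1 := lintegral_rpow_le_lintegral_rpow μ hpq.symm.lt hh
  rw [ENNReal.one_rpow, one_mul, one_div]
  exact (ENNReal.le_rpow_inv_iff hpq.symm.pos).2 h1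

/-- A finite mixture of Hölder's inequalities: if the density `f` has `p`-th moment at most `A`
with respect to `γ`, then the mixture with weights `w i` of the measures with density `f` satisfies
Hölder's inequality with the same constant. -/
lemma sum_lintegral_mul_le {ι : Type*} (s : Finset ι) (w : ι → ENNReal)
    (hw : ∑ i ∈ s, w i = 1) (hp : 1 < p) (γ : Measure Ω) {f : Ω → ENNReal} (hf : Measurable f)
    {A : ENNReal} (hA : ∫⁻ y, f y ^ p ∂γ ≤ A) {g : ι → Ω → ENNReal}
    (hg : ∀ i, Measurable (g i)) :
    ∑ i ∈ s, w i * ∫⁻ y, f y * g i y ∂γ ≤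
      A ^ (1 / p) *
        (∑ i ∈ s, w i * ∫⁻ y, g i y ^ p.conjExponent ∂γ) ^ (1 / p.conjExponent) := by
  have hpq := Real.HolderConjugate.conjExponent hp
  have hp' := hpq.symm.pos
  set p' := p.conjExponent
  have h1 : ∀ i, ∫⁻ y, f y * g i y ∂γ ≤ A ^ (1 / p) * (∫⁻ y, g i y ^ p' ∂γ) ^ (1 / p') := by
    intro i
    refine (ENNReal.lintegral_mul_le_Lp_mul_Lq γ hpq hf.aemeasurable (hg i).aemeasurable).trans ?_
    gcongr
  calc ∑ i ∈ s, w i * ∫⁻ y, f y * g i y ∂γ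
      ≤ ∑ i ∈ s, w i * (A ^ (1 / p) * (∫⁻ y, g i y ^ p' ∂γ) ^ (1 / p')) :=
        Finset.sum_le_sum fun i _ => mul_le_mul_right (h1 i) _
    _ = A ^ (1 / p) * ∑ i ∈ s, w i * (∫⁻ y, g i y ^ p' ∂γ) ^ (1 / p') := by
        rw [Finset.mul_sum]
        exact Finset.sum_congr rfl fun i _ => by ring
    _ ≤ _ := by
        gcongr
        rw [one_div, ENNReal.le_rpow_inv_iff hp']
        refine (ENNReal.rpow_arith_mean_le_arith_mean_rpow s w _ hw hpq.symm.lt.le).trans_eq ?_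
        refine Finset.sum_congr rfl fun i _ => ?_
        rw [← ENNReal.rpow_mul, inv_mul_cancel₀ hp'.ne', ENNReal.rpow_one]

/-- Composition: if the transition operator `T` on test functions is dominated by `T'` pointwise
with constant `A`, then one transition multiplies the constant of Hölder domination by `A`. -/
lemma HolderDominated.comp (hp : 1 < p) {A C : ENNReal} {μ ν μ' ν' : Measure Ω}
    (h : HolderDominated p C μ ν) {T T' : (Ω → ENNReal) → Ω → ENNReal}
    (hT : ∀ g, Measurable g → ∫⁻ x, g x ∂μ' = ∫⁻ x, T g x ∂μ)
    (hT' : ∀ g, Measurable g → ∫⁻ x, g x ∂ν' = ∫⁻ x, T' g x ∂ν)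
    (hmeas : ∀ g, Measurable g → Measurable (T' g))
    (hle : ∀ g, Measurable g → ∀ x,
      T g x ≤ A ^ (1 / p) * (T' (fun y => g y ^ p.conjExponent) x) ^ (1 / p.conjExponent)) :
    HolderDominated p (A * C) μ' ν' := by
  intro g hg
  have hpq := Real.HolderConjugate.conjExponent hp
  have hp' := hpq.symm.pos
  set p' := p.conjExponent
  have hgp : Measurable (fun y => g y ^ p') := by fun_prop
  have hm := hmeas _ hgp
  rw [hT g hg, hT' _ hgp]
  calc ∫⁻ x, T g x ∂μ ≤ ∫⁻ x, A ^ (1 / p) * (T' (fun y => g y ^ p') x) ^ (1 / p') ∂μ :=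
        lintegral_mono (hle g hg)
    _ = A ^ (1 / p) * ∫⁻ x, (T' (fun y => g y ^ p') x) ^ (1 / p') ∂μ :=
        lintegral_const_mul _ (by fun_prop)
    _ ≤ A ^ (1 / p) * (C ^ (1 / p) *
          (∫⁻ x, ((T' (fun y => g y ^ p') x) ^ (1 / p')) ^ p' ∂ν) ^ (1 / p')) := by
        gcongr
        exact h _ (by fun_prop)
    _ = _ := by
        simp_rw [← ENNReal.rpow_mul, one_div_mul_cancel hp'.ne', ENNReal.rpow_one]
        rw [← mul_assoc, ENNReal.mul_rpow_of_nonneg _ _ (by positivity)]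

/-- Conversion to approximate differential privacy. For an indicator test function, Hölder
domination reads `μ R ≤ C^(1/p) (ν R)^(1/p')`; Young's inequality, with the weights for which the
constant term is `δ`, gives exactly `rdpToDP`. -/
lemma HolderDominated.measure_le (hp : 1 < p) {ρ δ ε : ℝ} (hδ : 0 < δ) {μ ν : Measure Ω}
    (h : HolderDominated p (ENNReal.ofReal (Real.exp ((p - 1) * ρ))) μ ν)
    (hε : rdpToDP p ρ δ ≤ ε) {R : Set Ω} (hR : MeasurableSet R) :
    μ R ≤ ENNReal.ofReal (Real.exp ε) * ν R + ENNReal.ofReal δ := by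
  have hpq := Real.HolderConjugate.conjExponent hp
  have hp0 := hpq.pos
  have hp'0 := hpq.symm.pos
  have hp1 : 0 < p - 1 := by linarith
  have hp'def : p.conjExponent = p / (p - 1) := rfl
  have h1 := h (R.indicator 1) (measurable_one.indicator hR)
  set p' := p.conjExponent
  have hind : ∀ x, R.indicator (1 : Ω → ENNReal) x ^ p' = R.indicator 1 x := by
    intro x
    by_cases hx : x ∈ R <;> simp [hx, hp'0]
  simp_rw [hind] at h1
  rw [lintegral_indicator_one hR, lintegral_indicator_one hR] at h1
  set a : ENNReal := ENNReal.ofReal ((p * δ) ^ (1 / p)) with ha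
  set b : ENNReal := ENNReal.ofReal ((p' * Real.exp ε) ^ (1 / p')) * ν R ^ (1 / p') with hb
  have hC : ENNReal.ofReal (Real.exp ((p - 1) * ρ)) ^ (1 / p) ≤
      a * ENNReal.ofReal ((p' * Real.exp ε) ^ (1 / p')) := by
    rw [ENNReal.ofReal_rpow_of_nonneg (Real.exp_pos _).le (by positivity), ha,
      ← ENNReal.ofReal_mul (by positivity)]
    refine ENNReal.ofReal_le_ofReal ?_
    rw [Real.rpow_def_of_pos (by positivity), Real.rpow_def_of_pos (by positivity),
      Real.rpow_def_of_pos (by positivity), ← Real.exp_add, Real.exp_le_exp, Real.log_exp,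
      Real.log_mul hp0.ne' hδ.ne', Real.log_mul hp'0.ne' (Real.exp_pos _).ne', Real.log_exp]
    have hlog : Real.log p' = -Real.log ((p - 1) / p) := by
      rw [hp'def, ← Real.log_inv, inv_div]
    have hinv : 1 / p' = (p - 1) * (1 / p) := by rw [hp'def]; field_simp
    rw [rdpToDP] at hε
    rw [hlog, hinv, ← mul_assoc, ← add_mul]
    refine mul_le_mul_of_nonneg_right ?_ (by positivity)
    have h2 := mul_le_mul_of_nonneg_left hε hp1.le
    have h3 : (p - 1) * ((Real.log δ + Real.log p) / (p - 1)) = Real.log δ + Real.log p :=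
      mul_div_cancel₀ _ hp1.ne'
    linarith
  have hap : a ^ p / ENNReal.ofReal p = ENNReal.ofReal δ := by
    rw [ha, ENNReal.ofReal_rpow_of_nonneg (by positivity) hp0.le, ← Real.rpow_mul (by positivity),
      one_div_mul_cancel hp0.ne', Real.rpow_one, ← ENNReal.ofReal_div_of_pos hp0,
      mul_div_cancel_left₀ _ hp0.ne']
  have hbp : b ^ p' / ENNReal.ofReal p' = ENNReal.ofReal (Real.exp ε) * ν R := by
    rw [hb, ENNReal.mul_rpow_of_nonneg _ _ hp'0.le, ← ENNReal.rpow_mul,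
      ENNReal.ofReal_rpow_of_nonneg (by positivity) hp'0.le, ← Real.rpow_mul (by positivity),
      one_div_mul_cancel hp'0.ne', Real.rpow_one, ENNReal.rpow_one, div_eq_mul_inv,
      mul_right_comm, ← div_eq_mul_inv, ← ENNReal.ofReal_div_of_pos hp'0,
      mul_div_cancel_left₀ _ hp'0.ne']
  calc μ R ≤ _ := h1
    _ ≤ a * ENNReal.ofReal ((p' * Real.exp ε) ^ (1 / p')) * ν R ^ (1 / p') := by gcongr
    _ = a * b := by rw [hb, mul_assoc]
    _ ≤ a ^ p / ENNReal.ofReal p + b ^ p' / ENNReal.ofReal p' := ENNReal.young_inequality a b hpq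
    _ = _ := by rw [hap, hbp, add_comm]

end Holder

/-! ### One training iteration -/

lemma norm_clipGrad_le {d : ℕ} {r : ℝ} (hr : 0 < r) (g : EuclideanSpace ℝ (Fin d)) :
    ‖clipGrad r g‖ ≤ r := by
  have hm : 0 < max 1 (‖g‖ / r) := lt_max_of_lt_left one_pos
  rw [clipGrad, norm_smul, norm_inv, Real.norm_of_nonneg hm.le, inv_mul_le_iff₀ hm]
  have := mul_le_mul_of_nonneg_right (le_max_right 1 (‖g‖ / r)) hr.le
  rwa [div_mul_cancel₀ _ hr.ne'] at this

@[fun_prop]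
lemma measurable_clipGrad {d : ℕ} (r : ℝ) :
    Measurable (clipGrad r : EuclideanSpace ℝ (Fin d) → _) := by
  unfold clipGrad; fun_prop

/-- The derivative of an arbitrary real function is measurable, with its value `0` where it does
not exist; hence the loss need not be regular in any way. -/
@[fun_prop]
lemma measurable_gradient {d : ℕ} (f : EuclideanSpace ℝ (Fin d) → ℝ) :
    Measurable (gradient f) :=
  (LinearIsometryEquiv.continuous _).measurable.comp (measurable_fderiv ℝ f)

/-- The probability with which Poisson sampling at rate `q` draws the mini-batch `L` from `D`. -/
def sampleWeight {𝒳 : Type*} (q : ℝ) (D L : Finset 𝒳) : ENNReal :=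
  ENNReal.ofReal (q ^ L.card * (1 - q) ^ (D.card - L.card))

lemma sum_sampleWeight {𝒳 : Type*} {q : ℝ} (hq : 0 ≤ q) (hq1 : q ≤ 1) (D : Finset 𝒳) :
    ∑ L ∈ D.powerset, sampleWeight q D L = 1 := by
  have h1 : 0 ≤ 1 - q := sub_nonneg.2 hq1
  simp_rw [sampleWeight]
  rw [← ENNReal.ofReal_sum_of_nonneg fun L _ => by positivity,
    Finset.sum_pow_mul_eq_add_pow]
  simp

/-- Conditioning the mini-batch on whether it contains the point `x`. -/
lemma sum_powerset_cons_sampleWeight {𝒳 : Type*} {q : ℝ} (hq : 0 ≤ q) (hq1 : q ≤ 1)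
    (D : Finset 𝒳) {x : 𝒳} (hx : x ∉ D) (F F' : Finset 𝒳 → ENNReal)
    (hF : ∀ L (hL : x ∉ L), F (Finset.cons x L hL) = F' L) :
    ∑ L ∈ (Finset.cons x D hx).powerset, sampleWeight q (Finset.cons x D hx) L * F L =
      ∑ L ∈ D.powerset, sampleWeight q D L *
        (ENNReal.ofReal (1 - q) * F L + ENNReal.ofReal q * F' L) := by
  classical
  have h1 : 0 ≤ 1 - q := sub_nonneg.2 hq1
  have hcons : (Finset.cons x D hx).powerset = (insert x D).powerset := by
    rw [Finset.cons_eq_insert]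
  rw [hcons, Finset.sum_powerset_insert hx, ← Finset.sum_add_distrib]
  refine Finset.sum_congr rfl fun L hL => ?_
  rw [Finset.mem_powerset] at hL
  have hxL : x ∉ L := fun h => hx (hL h)
  have hcard := Finset.card_le_card hL
  rw [← Finset.cons_eq_insert x L hxL, hF L hxL, sampleWeight, sampleWeight, sampleWeight,
    Finset.card_cons, Finset.card_cons, Nat.add_sub_add_right, Nat.sub_add_comm hcard,
    show q ^ L.card * (1 - q) ^ (D.card - L.card + 1) =
      q ^ L.card * (1 - q) ^ (D.card - L.card) * (1 - q) by ring,
    show q ^ (L.card + 1) * (1 - q) ^ (D.card - L.card) =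
      q ^ L.card * (1 - q) ^ (D.card - L.card) * q by ring,
    ENNReal.ofReal_mul' h1, ENNReal.ofReal_mul' hq]
  ring

namespace ScaleConfig

variable {𝒳 : Type*} {d P : ℕ} (S : ScaleConfig 𝒳 d P)

lemma measurable_update (L : Finset 𝒳) :
    Measurable (fun y : EuclideanSpace ℝ (Fin d) × EuclideanSpace ℝ (Fin d) =>
      S.update L y.1 y.2) := by
  unfold update
  fun_prop

/-- The transition operator of one training iteration: the conditional expectation of the test
function `h` at the next parameters, given the current ones. -/
def transition (D : Finset 𝒳) (h : EuclideanSpace ℝ (Fin d) → ENNReal)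
    (θ : EuclideanSpace ℝ (Fin d)) : ENNReal :=
  ∑ L ∈ D.powerset, sampleWeight S.q D L *
    ∫⁻ z, h (S.update L θ z) ∂stdGaussian (EuclideanSpace ℝ (Fin d))

lemma measurable_lintegral_update (L : Finset 𝒳) {h : EuclideanSpace ℝ (Fin d) → ENNReal}
    (hh : Measurable h) :
    Measurable (fun θ => ∫⁻ z, h (S.update L θ z) ∂stdGaussian (EuclideanSpace ℝ (Fin d))) :=
  (hh.comp (S.measurable_update L)).lintegral_prod_right'

lemma measurable_transition (D : Finset 𝒳) {h : EuclideanSpace ℝ (Fin d) → ENNReal}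
    (hh : Measurable h) : Measurable (S.transition D h) :=
  Finset.measurable_fun_sum _ fun L _ => (S.measurable_lintegral_update L hh).const_mul _

lemma lintegral_step (D : Finset 𝒳) (μ : Measure (EuclideanSpace ℝ (Fin d)))
    {h : EuclideanSpace ℝ (Fin d) → ENNReal} (hh : Measurable h) :
    ∫⁻ θ, h θ ∂S.step D μ = ∫⁻ θ, S.transition D h θ ∂μ := by
  simp_rw [step, transition]
  rw [lintegral_finsetSum_measure, lintegral_finsetSum _ fun L _ =>
    (S.measurable_lintegral_update L hh).const_mul _]
  refine Finset.sum_congr rfl fun L _ => ?_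
  rw [lintegral_smul_measure, lintegral_map hh (S.measurable_update L),
    lintegral_prod (fun y => h (S.update L y.1 y.2))
      (hh.comp (S.measurable_update L)).aemeasurable,
    lintegral_const_mul _ (S.measurable_lintegral_update L hh), smul_eq_mul, sampleWeight]

/-- The clipped gradient of the point `x` in units of the noise: the amount by which sampling `x`
shifts the Gaussian noise. -/
def noiseShift (x : 𝒳) (θ : EuclideanSpace ℝ (Fin d)) : EuclideanSpace ℝ (Fin d) :=
  (S.σscale * S.c)⁻¹ •
    clipGrad (S.clipNorm (S.group x)) (gradient (fun θ' => S.loss θ' x) θ)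

lemma update_cons (hc : 0 < S.c) (hσscale : 0 < S.σscale) (L : Finset 𝒳) (x : 𝒳) (hx : x ∉ L)
    (θ z : EuclideanSpace ℝ (Fin d)) :
    S.update (Finset.cons x L hx) θ z = S.update L θ (z + S.noiseShift x θ) := by
  have h : S.σscale * S.c ≠ 0 := (mul_pos hσscale hc).ne'
  rw [update, update, Finset.sum_cons, noiseShift,
    smul_add (S.σscale * S.c) z, smul_inv_smul₀ h]
  congr 3
  abel

/-- The effective noise multiplier of the group of `x` is the targeted one. -/
lemma norm_noiseShift_sq_le (hc : 0 < S.c) (hσscale : 0 < S.σscale) (x : 𝒳)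
    (hσ : 0 < S.σ (S.group x)) (θ : EuclideanSpace ℝ (Fin d)) :
    ‖S.noiseShift x θ‖ ^ 2 ≤ 1 / S.σ (S.group x) ^ 2 := by
  have h : 0 < S.σscale * S.c := mul_pos hσscale hc
  have h1 : ‖S.noiseShift x θ‖ ≤ 1 / S.σ (S.group x) := by
    rw [noiseShift, norm_smul, norm_inv, Real.norm_of_nonneg h.le, inv_mul_le_iff₀ h, mul_one_div]
    exact norm_clipGrad_le (div_pos h hσ) _
  calc ‖S.noiseShift x θ‖ ^ 2 ≤ (1 / S.σ (S.group x)) ^ 2 := by gcongr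
    _ = _ := by rw [div_pow, one_pow]

/-- Under the dataset with the additional point `x`, the noise has the law of the sampled Gaussian
mechanism with shift `noiseShift x θ`. -/
lemma transition_cons (hq : 0 < S.q) (hq1 : S.q ≤ 1) (hc : 0 < S.c) (hσscale : 0 < S.σscale)
    (D : Finset 𝒳) {x : 𝒳} (hx : x ∉ D) {h : EuclideanSpace ℝ (Fin d) → ENNReal}
    (hh : Measurable h) (θ : EuclideanSpace ℝ (Fin d)) :
    S.transition (Finset.cons x D hx) h θ = ∑ L ∈ D.powerset, sampleWeight S.q D L *
      ∫⁻ z, ENNReal.ofReal (shiftRatio S.q (S.noiseShift x θ) z) * h (S.update L θ z)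
        ∂stdGaussian (EuclideanSpace ℝ (Fin d)) := by
  rw [transition, sum_powerset_cons_sampleWeight hq.le hq1 D hx _ (fun L =>
    ∫⁻ z, h (S.update L θ (z + S.noiseShift x θ)) ∂stdGaussian (EuclideanSpace ℝ (Fin d)))
    fun L hL => by simp_rw [S.update_cons hc hσscale L x hL]]
  refine Finset.sum_congr rfl fun L _ => ?_
  rw [lintegral_shiftRatio_mul hq hq1 _ (g := fun z => h (S.update L θ z))
    (hh.comp ((S.measurable_update L).comp measurable_prodMk_left))]

lemma transition_cons_le (hq : 0 < S.q) (hq1 : S.q ≤ 1) (hc : 0 < S.c) (hσscale : 0 < S.σscale)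
    (D : Finset 𝒳) {x : 𝒳} (hx : x ∉ D) (hσ : 0 < S.σ (S.group x)) {α : ℝ} (hα : 1 < α)
    {h : EuclideanSpace ℝ (Fin d) → ENNReal} (hh : Measurable h)
    (θ : EuclideanSpace ℝ (Fin d)) :
    S.transition (Finset.cons x D hx) h θ ≤
      sgmMoment S.q (1 / S.σ (S.group x) ^ 2).toNNReal α ^ (1 / α) *
        (S.transition D (fun y => h y ^ α.conjExponent) θ) ^ (1 / α.conjExponent) := by
  rw [S.transition_cons hq hq1 hc hσscale D hx hh]
  refine sum_lintegral_mul_le _ _ (sum_sampleWeight hq.le hq1 D) hα _ (by fun_prop) ?_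
    fun L => hh.comp ((S.measurable_update L).comp measurable_prodMk_left)
  simp_rw [ENNReal.ofReal_rpow_of_nonneg (shiftRatio_pos hq hq1 _ _).le (by linarith : 0 ≤ α)]
  rw [lintegral_shiftRatio_rpow]
  exact sgmMoment_mono hq hq1 hα
    (Real.toNNReal_le_toNNReal (S.norm_noiseShift_sq_le hc hσscale x hσ θ))

/-- The direction in which the point is removed: relative to the noise with density `shiftRatio`,
the standard Gaussian noise has the inverse density. -/
lemma transition_le_cons (hq : 0 < S.q) (hq1 : S.q ≤ 1) (hc : 0 < S.c) (hσscale : 0 < S.σscale)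
    (D : Finset 𝒳) {x : 𝒳} (hx : x ∉ D) (hσ : 0 < S.σ (S.group x)) {α : ℝ} (hα : 1 < α)
    {h : EuclideanSpace ℝ (Fin d) → ENNReal} (hh : Measurable h)
    (θ : EuclideanSpace ℝ (Fin d)) :
    S.transition D h θ ≤
      sgmMoment S.q (1 / S.σ (S.group x) ^ 2).toNNReal α ^ (1 / α) *
        (S.transition (Finset.cons x D hx) (fun y => h y ^ α.conjExponent) θ) ^
          (1 / α.conjExponent) := by
  set v := S.noiseShift x θ
  have hpos := fun z => shiftRatio_pos hq hq1 v z
  have hup : ∀ L, Measurable (fun z => h (S.update L θ z)) := fun L =>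
    hh.comp ((S.measurable_update L).comp measurable_prodMk_left)
  have hden : ∀ g : EuclideanSpace ℝ (Fin d) → ENNReal, Measurable g →
      ∫⁻ z, g z ∂(stdGaussian (EuclideanSpace ℝ (Fin d))).withDensity
        (fun z => ENNReal.ofReal (shiftRatio S.q v z)) =
      ∫⁻ z, ENNReal.ofReal (shiftRatio S.q v z) * g z ∂stdGaussian _ := fun g hg =>
    lintegral_withDensity_eq_lintegral_mul _ (by fun_prop) hg
  have hmain := sum_lintegral_mul_le D.powerset (sampleWeight S.q D)
    (sum_sampleWeight hq.le hq1 D) hα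
    ((stdGaussian (EuclideanSpace ℝ (Fin d))).withDensity
        (fun z => ENNReal.ofReal (shiftRatio S.q v z)))
    (f := fun z => ENNReal.ofReal ((shiftRatio S.q v z)⁻¹)) (by fun_prop)
    (A := sgmMoment S.q (1 / S.σ (S.group x) ^ 2).toNNReal α) ?_ hup
  · rw [S.transition_cons hq hq1 hc hσscale D hx (by fun_prop)]
    convert hmain using 1
    · refine Finset.sum_congr rfl fun L _ => ?_
      rw [hden (fun z => ENNReal.ofReal (shiftRatio S.q v z)⁻¹ * h (S.update L θ z))
        (Measurable.mul (by fun_prop) (hup L))]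
      congr 1
      refine lintegral_congr fun z => ?_
      rw [← mul_assoc, ← ENNReal.ofReal_mul (hpos z).le, mul_inv_cancel₀ (hpos z).ne',
        ENNReal.ofReal_one, one_mul]
    · congr 2
      refine Finset.sum_congr rfl fun L _ => ?_
      rw [hden (fun z => h (S.update L θ z) ^ α.conjExponent) ((hup L).pow_const _)]
  · rw [hden _ (by fun_prop)]
    have hpow : ∀ z, ENNReal.ofReal (shiftRatio S.q v z) *
        ENNReal.ofReal ((shiftRatio S.q v z)⁻¹) ^ α =
        ENNReal.ofReal (shiftRatio S.q v z ^ (1 - α)) := by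
      intro z
      rw [ENNReal.ofReal_rpow_of_nonneg (inv_nonneg.2 (hpos z).le) (by linarith),
        ← ENNReal.ofReal_mul (hpos z).le, Real.inv_rpow (hpos z).le,
        Real.rpow_sub (hpos z), Real.rpow_one, div_eq_mul_inv]
    simp_rw [hpow]
    rw [lintegral_shiftRatio_rpow]
    exact (sgmMoment_one_sub_le hq hq1 hα _).trans (sgmMoment_mono hq hq1 hα
      (Real.toNNReal_le_toNNReal (S.norm_noiseShift_sq_le hc hσscale x hσ θ)))

/-! ### Privacy of the whole training -/

/-- Hölder domination of one training by another follows from that of the transition operators. -/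
lemma holderDominated_train [IsProbabilityMeasure S.init] {D D' : Finset 𝒳} {α : ℝ} (hα : 1 < α)
    {A : ENNReal} (hle : ∀ h : EuclideanSpace ℝ (Fin d) → ENNReal, Measurable h → ∀ θ,
      S.transition D h θ ≤
        A ^ (1 / α) *
          (S.transition D' (fun y => h y ^ α.conjExponent) θ) ^ (1 / α.conjExponent))
    (I : ℕ) : HolderDominated α (A ^ I) (S.train I D) (S.train I D') := by
  induction I with
  | zero => simpa [train] using holderDominated_self hα S.init
  | succ n ih =>
    simp only [train, Function.iterate_succ_apply'] at ih ⊢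
    rw [pow_succ']
    exact ih.comp hα (fun g hg => S.lintegral_step D _ hg) (fun g hg => S.lintegral_step D' _ hg)
      (fun g hg => S.measurable_transition D' hg) hle

end ScaleConfig

/-- The closed-form case of the accountant is subsumed by the exact one. -/
lemma MeetsBudget.exists_exact {q δ σ ε : ℝ} {I : ℕ} (hq : 0 < q) (h : MeetsBudget q δ I σ ε) :
    ∃ α : ℝ, 1 < α ∧ rdpToDP α (I * sgmExactCost q σ α) δ ≤ ε := by
  obtain ⟨α, hα, h | ⟨hreg, h⟩⟩ := h
  · exact ⟨α, hα, h⟩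
  · refine ⟨α, hα, le_trans ?_ h⟩
    have := mul_le_mul_of_nonneg_left (sgmExactCost_le_sgmClosedFormCost hq hα hreg)
      (Nat.cast_nonneg I)
    unfold rdpToDP
    linarith

/-- IDP-SGD with the Scale mechanism is `({ε_1, …, ε_P}, δ)`-individually differentially private,
when each noise multiplier `σ_p` meets the budget `(ε_p, δ)` of its group, and the group's points
are clipped to `c_p = σ_scale · c / σ_p`. The common multiplier `σ_scale` may be any positive number
fixed before training, such as the inverse of `(1/N) ∑_p |G_p| / σ_p`. -/
theorem mainTheorem2 {𝒳 : Type*} {d P : ℕ} (S : ScaleConfig 𝒳 d P) (I : ℕ)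
    (hinit : IsProbabilityMeasure S.init)
    (hB : 0 < S.batchSize) (hq : 0 < S.q) (hq1 : S.q ≤ 1) (hc : 0 < S.c)
    (hσ : ∀ p, 0 < S.σ p) (hσscale : 0 < S.σscale)
    (ε : Fin P → ℝ) (δ : ℝ) (hδ : 0 < δ) (hδ1 : δ ≤ 1)
    (hbudget : ∀ p, MeetsBudget S.q δ I (S.σ p) (ε p)) :
    IsIDP (S.train I) S.group ε δ := by
  intro D x hx R hR
  obtain ⟨α, hα, hε⟩ := (hbudget (S.group x)).exists_exact hq
  have hpow : sgmMoment S.q (1 / S.σ (S.group x) ^ 2).toNNReal α ^ I =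
      ENNReal.ofReal (Real.exp ((α - 1) * (I * sgmExactCost S.q (S.σ (S.group x)) α))) := by
    rw [sgmMoment_eq_exp_sgmExactCost hq hq1 (hσ _) hα, ← ENNReal.ofReal_pow (Real.exp_pos _).le,
      ← Real.exp_nat_mul]
    ring_nf
  constructor
  · have h := S.holderDominated_train hα
      (fun h hh θ => S.transition_cons_le hq hq1 hc hσscale D hx (hσ _) hα hh θ) I
    rw [hpow] at h
    exact h.measure_le hα hδ hε hR
  · have h := S.holderDominated_train hα
      (fun h hh θ => S.transition_le_cons hq hq1 hc hσscale D hx (hσ _) hα hh θ) I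
    rw [hpow] at h
    exact h.measure_le hα hδ hε hR

end
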